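/- Let $d\ge 4$ and $\varepsilon>0$. There is a non-degenerate $d$-simplex $S$ in Euclidean space $\mathbb{E}^d$ whose incenter (the center of the sphere inside $S$ tangent to all its facets) coincides with its Fermat–Torricelli point (the unique point whose sum of distances to the vertices of $S$ is minimal), but which is not equifacetal, i.e. not all of its facets are congruent. Moreover, $S$ can be chosen isosceles over a non-regular equifacetal base close to a regular simplex: $S$ has a vertex $P$ such that all edges of $S$ at $P$ have the same length, the facet $T$ of $S$ opposite to $P$ is an equifacetal $(d-1)$-simplex that is not regular (not all its edges have equal length), and there are a regular $(d-1)$-simplex $T_0\subset\mathbb{E}^d$ of edge length $1$ and a labelling $A_1,\dots,A_d$ of the vertices of $T$ and $B_1,\dots,B_d$ of those of $T_0$ with $\|A_i-B_i\|<\varepsilon$ for all $i$. -/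

import Mathlib

namespace Affine.Simplex

variable {V P : Type*} [NormedAddCommGroup V] [InnerProductSpace ℝ V] [MetricSpace P]
  [NormedAddTorsor V P] {n : ℕ}

/-- `p` is the Fermat–Torricelli point of `S`: the unique point of the ambient space whose sum of
distances to the vertices of `S` is minimal. -/
def IsFermatTorricelliPoint (S : Affine.Simplex ℝ P n) (p : P) : Prop :=
  ∀ q : P, q ≠ p → ∑ i, dist p (S.points i) < ∑ i, dist q (S.points i)

/-- `S` is equifacetal: any two of its facets are congruent. The facet opposite to the vertex `i`
has the vertices `S.points k` with `k ≠ i`, and two facets are congruent if some bijection between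
their vertices preserves all distances. -/
def Equifacetal (S : Affine.Simplex ℝ P n) : Prop :=
  ∀ i j : Fin (n + 1), ∃ σ : {k // k ≠ i} ≃ {k // k ≠ j},
    Congruent (fun k : {k // k ≠ i} => S.points k) (fun k : {k // k ≠ i} => S.points (σ k))

/-- `S` is isosceles with apex the vertex `a`: all edges emanating from `a` have equal length. -/
def IsIsoscelesAt (S : Affine.Simplex ℝ P n) (a : Fin (n + 1)) : Prop :=
  ∃ l : ℝ, ∀ i, i ≠ a → dist (S.points a) (S.points i) = l

end Affine.Simplex

/-!
Let `T` be a `(d-1)`-simplex whose symmetries act transitively on its vertices. Its circumcenter,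
centroid and incenter agree; call this point `O`, and let `R` and `r` be its circumradius and
inradius. Put an apex on the axis through `O` orthogonal to `T`. At a point `X` of the axis at
height `t` over `T`, below the apex, the unit vectors towards the vertices sum to zero iff
`t = R / √(d² - 1)`, whatever the height `h` of the apex. On the other hand `X` is the incenter iff
`h = 2 t r² / (r² - t²)`, which requires `t < r`. For a regular simplex `R / r = d - 1 < √(d² - 1)`,
so for `T` close to a regular simplex a suitable apex exists
(`Affine.Simplex.exists_isosceles_incenter_isFermatTorricelliPoint`).

The computations are linear algebra in `ℝ^d` with `T` in a hyperplane `∑ xᵢ = σ`. If `ν` is the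
family dual to the vertices of `T`, the gradients of the barycentric coordinates of the
`d`-simplex are explicit in terms of `ν` and the vector `(1, …, 1)`; their norms are the inverse
heights, which are proportional to the barycentric coordinates of the incenter
(`Affine.Simplex.incenter_eq_sum_of_inner`).

The base has the vertices `σ ((1 - δ) eᵢ + δ eᵢ₊₁)`, with indices modulo `d`. Cyclic shifts of the
coordinates act transitively on them, and for `d ≥ 4` two consecutive vertices are at another
distance than two vertices whose indices differ by `2`, so `T` is equifacetal and not regular. The
whole simplex is not equifacetal because an equifacetal isosceles simplex is equilateral
(`Affine.Simplex.Equifacetal.dist_eq_of_isIsoscelesAt`).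
-/

open scoped RealInnerProductSpace

namespace Affine.Simplex

/-! ### Heights and the incenter -/

variable {V : Type*} [NormedAddCommGroup V] [InnerProductSpace ℝ V] {n : ℕ}

/-- If `g` is the gradient of the `i`-th barycentric coordinate of a full-dimensional simplex, then
`‖g‖` is the inverse of the `i`-th height. -/
lemma height_mul_norm_eq_one [NeZero n] (hn : Module.finrank ℝ V = n) (S : Simplex ℝ V n)
    (i : Fin (n + 1)) {g : V} (hg : ∀ j, j ≠ i → ⟪S.points i - S.points j, g⟫ = 1) :
    S.height i * ‖g‖ = 1 := by
  have : FiniteDimensional ℝ V :=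
    Module.finite_of_finrank_pos (hn ▸ Nat.pos_of_ne_zero (NeZero.ne n))
  have htop : vectorSpan ℝ (Set.range S.points) = ⊤ := by
    have := S.independent.affineSpan_eq_top_iff_card_eq_finrank_add_one.2 (by simp [hn])
    rw [← direction_affineSpan, this, AffineSubspace.direction_top]
  -- Both sides have the same inner product with every edge at the vertex `i`.
  have key : S.points i - S.altitudeFoot i = S.height i ^ 2 • g := by
    rw [← sub_eq_zero, ← Submodule.mem_bot ℝ, ← Submodule.top_orthogonal_eq_bot, ← htop,
      vectorSpan_range_eq_span_range_vsub_left ℝ S.points i, Submodule.mem_orthogonal]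
    intro u hu
    induction hu using Submodule.span_induction with
    | mem u hu =>
      obtain ⟨j, rfl⟩ := hu
      obtain rfl | hj := eq_or_ne j i
      · simp
      · have h := S.inner_vsub_vsub_altitudeFoot_eq_height_sq hj.symm
        simp only [vsub_eq_sub] at h ⊢
        rw [inner_sub_right, h, real_inner_smul_right, hg j hj, mul_one, sub_self]
    | zero => simp
    | add x y _ _ hx hy => rw [inner_add_left, hx, hy, add_zero]
    | smul a x _ hx => rw [real_inner_smul_left, hx, mul_zero]
  have hh : S.height i = S.height i ^ 2 * ‖g‖ := by
    conv_lhs => rw [height, dist_eq_norm, key, norm_smul, Real.norm_of_nonneg (sq_nonneg _)]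
  have h0 := S.height_pos i
  refine mul_left_cancel₀ h0.ne' ?_
  linear_combination -hh

/-- A point whose barycentric coordinates are proportional to the inverse heights, here the norms
of the gradients `g i` of the barycentric coordinates, is the incenter. -/
lemma incenter_eq_sum_of_inner [NeZero n] (hn : Module.finrank ℝ V = n) (S : Simplex ℝ V n)
    (g : Fin (n + 1) → V) (hg : ∀ i j, j ≠ i → ⟪S.points i - S.points j, g i⟫ = 1)
    {w : Fin (n + 1) → ℝ} (hw : ∑ i, w i = 1) {r : ℝ} (hr : ∀ i, w i = r * ‖g i‖) :
    S.incenter = ∑ i, w i • S.points i := by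
  have hinv : ∀ i, (S.height i)⁻¹ = ‖g i‖ := fun i =>
    inv_eq_of_mul_eq_one_right (S.height_mul_norm_eq_one hn i (hg i))
  have hsum : r * ∑ i, ‖g i‖ = 1 := by rw [Finset.mul_sum, ← hw]; simp only [hr]
  rw [incenter_eq_affineCombination, Finset.affineCombination_eq_linear_combination _ _ _
    (by simp)]
  refine Finset.sum_congr rfl fun i _ => ?_
  congr 1
  simp only [excenterWeights, excenterWeightsUnnorm_empty_apply, Pi.smul_apply, smul_eq_mul, hinv,
    hr]
  rw [inv_eq_of_mul_eq_one_left hsum]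

/-! ### The Fermat–Torricelli point -/

/-- A point at which the unit vectors towards the vertices sum to zero is the Fermat–Torricelli
point, provided that it is not collinear with all the vertices. A vertex equal to `X` contributes
nothing to the sum, since then `‖0‖⁻¹ • 0 = 0`. -/
lemma isFermatTorricelliPoint_of_sum_unit_eq_zero (S : Simplex ℝ V n) {X : V}
    (h0 : ∑ i, ‖S.points i - X‖⁻¹ • (S.points i - X) = 0) {i j : Fin (n + 1)}
    (hij : LinearIndependent ℝ ![S.points i - X, S.points j - X]) :
    S.IsFermatTorricelliPoint X := by
  intro q hq
  have hle : ∀ k, ‖S.points k - X‖⁻¹ * ⟪S.points k - q, S.points k - X⟫ ≤ ‖S.points k - q‖ := by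
    intro k
    rcases (norm_nonneg (S.points k - X)).eq_or_lt with h | h
    · rw [← h]; simp
    · rw [inv_mul_le_iff₀ h, mul_comm]
      exact real_inner_le_norm _ _
  have hsum : ∑ k, ‖S.points k - X‖⁻¹ * ⟪S.points k - q, S.points k - X⟫
      = ∑ k, ‖S.points k - X‖ := by
    have hk : ∀ k, ‖S.points k - X‖⁻¹ * ⟪S.points k - q, S.points k - X⟫
        = ‖S.points k - X‖ + ⟪X - q, ‖S.points k - X‖⁻¹ • (S.points k - X)⟫ := by
      intro k
      have e : S.points k - q = (S.points k - X) + (X - q) := by abel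
      rw [e, inner_add_left, real_inner_self_eq_norm_sq, real_inner_smul_right, mul_add]
      congr 1
      rcases eq_or_ne ‖S.points k - X‖ 0 with h | h
      · simp [h]
      · field_simp
    rw [Finset.sum_congr rfl fun k _ => hk k, Finset.sum_add_distrib, ← inner_sum, h0,
      inner_zero_right, add_zero]
  simp only [dist_eq_norm, norm_sub_rev X, norm_sub_rev q]
  -- The inequality follows by Cauchy–Schwarz, with equality only if `q - X` is parallel to every
  -- vector from `X` to a vertex.
  rw [← hsum]
  refine lt_of_le_of_ne (Finset.sum_le_sum fun k _ => hle k) fun heq => hq ?_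
  have hall := (Finset.sum_eq_sum_iff_of_le fun k _ => hle k).1 heq
  have hpar : ∀ k, S.points k - X ≠ 0 → ∃ a : ℝ, q - X = a • (S.points k - X) := by
    intro k hk
    have hk' := norm_pos_iff.2 hk
    have h1 := hall k (Finset.mem_univ k)
    rw [inv_mul_eq_iff_eq_mul₀ hk'.ne', mul_comm, inner_eq_norm_mul_iff_real] at h1
    refine ⟨1 - ‖S.points k - X‖⁻¹ * ‖S.points k - q‖, ?_⟩
    rw [sub_smul, one_smul, mul_smul, ← h1, smul_smul, inv_mul_cancel₀ hk'.ne', one_smul]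
    abel
  obtain ⟨a, ha⟩ := hpar i (by simpa using hij.ne_zero 0)
  obtain ⟨b, hb⟩ := hpar j (by simpa using hij.ne_zero 1)
  have := (LinearIndependent.pair_iff.1 hij a (-b) (by rw [neg_smul, ← ha, ← hb]; abel)).1
  rw [this, zero_smul] at ha
  exact sub_eq_zero.1 ha

/-! ### Equifacetal simplices -/

/-- A simplex whose symmetries act transitively on its vertices is equifacetal. -/
lemma equifacetal_of_transitive (T : Simplex ℝ V n)
    (h : ∀ i j, ∃ e : Equiv.Perm (Fin (n + 1)), e i = j ∧
      ∀ k l, dist (T.points (e k)) (T.points (e l)) = dist (T.points k) (T.points l)) :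
    T.Equifacetal := by
  intro i j
  obtain ⟨e, rfl, he⟩ := h i j
  refine ⟨e.subtypeEquiv fun k => by simp, ?_⟩
  rw [congruent_iff_dist_eq]
  intro k l
  exact (he k l).symm

/-- An equifacetal isosceles simplex is equilateral. Summing any function of the edge lengths over
a facet gives the same value for all facets, hence so does summing it over the edges at a vertex.
For the squared deviation from the length `l` of the edges at the apex, that value is zero. -/
lemma Equifacetal.dist_eq_of_isIsoscelesAt {S : Simplex ℝ V n} (hS : S.Equifacetal)
    {a : Fin (n + 1)} {l : ℝ} (hl : ∀ i, i ≠ a → dist (S.points a) (S.points i) = l)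
    {i j : Fin (n + 1)} (hij : i ≠ j) : dist (S.points i) (S.points j) = l := by
  classical
  set f : Fin (n + 1) → Fin (n + 1) → ℝ := fun i j => (dist (S.points i) (S.points j) - l) ^ 2
    with hf
  have hsymm : ∀ i j, f i j = f j i := fun i j => by simp only [hf, dist_comm]
  have hfacet : ∀ i j : Fin (n + 1), ∑ k : {k // k ≠ i}, ∑ m : {m // m ≠ i}, f k m
      = ∑ k : {k // k ≠ j}, ∑ m : {m // m ≠ j}, f k m := by
    intro i j
    obtain ⟨σ, hσ⟩ := hS i j
    refine Fintype.sum_equiv σ _ (fun k => ∑ m : {m // m ≠ j}, f k m) fun k =>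
      Fintype.sum_equiv σ _ (fun m => f (σ k) m) fun m => ?_
    simp only [hf, hσ.dist_eq k m]
  -- Split the sum over all pairs of vertices into the pairs that contain `i` and the others.
  have hdecomp : ∀ i, ∑ k, ∑ m, f k m = f i i + 2 * ∑ k : {k // k ≠ i}, f i k
      + ∑ k : {k // k ≠ i}, ∑ m : {m // m ≠ i}, f k m := by
    intro i
    have hs : ∀ F : Fin (n + 1) → ℝ, ∑ k, F k = F i + ∑ k : {k // k ≠ i}, F k := fun F =>
      Fintype.sum_eq_add_sum_subtype_ne F i
    rw [hs fun k => ∑ m, f k m]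
    simp only [hs (f _), Finset.sum_add_distrib]
    simp only [hsymm _ i]
    ring
  have hstar : ∀ i, ∑ k : {k // k ≠ i}, f i k = 0 := by
    intro i
    have ha : ∑ k : {k // k ≠ a}, f a k = 0 :=
      Finset.sum_eq_zero fun k _ => by simp [hf, hl k k.2]
    have h1 := hdecomp i
    rw [hdecomp a, hfacet a i, ha] at h1
    have h2 : f i i = f a a := by simp [hf]
    linarith
  have h := (Finset.sum_eq_zero_iff_of_nonneg fun k _ => sq_nonneg _).1 (hstar i)
    ⟨j, hij.symm⟩ (Finset.mem_univ _)
  exact sub_eq_zero.1 (pow_eq_zero_iff two_ne_zero |>.1 h)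

/-! ### Isosceles simplices over a symmetric base -/

/-- Let the vertices `A i` of the base and their dual family `ν` each have constant norm, and let
the axis direction `o` satisfy `⟪A i, o⟫ = σ` and `∑ i, A i = σ • o`. If the base is round enough
(`hround`, which bounds the ratio of its circumradius to its inradius by `√(d ^ 2 - 1)`, where
`d = n + 1`), some point of the axis is the apex of an isosceles simplex over the base whose
incenter is its Fermat–Torricelli point. -/
lemma exists_isosceles_incenter_isFermatTorricelliPoint (hd : Module.finrank ℝ V = n + 1)
    (hn : 1 ≤ n) {o : V} {A ν : Fin (n + 1) → V} {σ N M : ℝ} (hσ : 0 < σ)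
    (ho : ⟪o, o⟫ = (n + 1 : ℝ)) (hAo : ∀ i, ⟪A i, o⟫ = σ) (hsum : ∑ i, A i = σ • o)
    (hA : ∀ i, ⟪A i, A i⟫ = N) (hν : ∀ i, ⟪ν i, ν i⟫ = M)
    (hνA : ∀ i j, ⟪ν i, A j⟫ = if i = j then 1 else 0)
    (hround : ((n + 1) * N - σ ^ 2) * ((n + 1) * M - (σ ^ 2)⁻¹) < (n + 1 : ℝ) ^ 2 - 1) :
    ∃ (S : Simplex ℝ V (n + 1)) (P : V), S.points = Fin.cons P A ∧
      S.IsFermatTorricelliPoint S.incenter ∧ S.IsIsoscelesAt 0 := by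
  set d : ℝ := n + 1 with hdd
  have hd2 : 2 ≤ d := by
    have : (1 : ℝ) ≤ n := by exact_mod_cast hn
    linarith
  have hd0 : 0 < d := by linarith
  have hνo : ∀ i, ⟪ν i, o⟫ = σ⁻¹ := by
    intro i
    have h : ⟪ν i, ∑ j, A j⟫ = 1 := by simp [inner_sum, hνA]
    rw [hsum, real_inner_smul_right] at h
    exact (inv_eq_of_mul_eq_one_right h).symm
  have h01 : (0 : Fin (n + 1)) ≠ Fin.last n := by
    intro h
    have := congrArg Fin.val h
    simp at this
    omega
  -- The circumradius of the base is positive: its square is `(d * N - σ ^ 2) / d`.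
  have hN : 0 < d * N - σ ^ 2 := by
    have hne : A 0 - (σ / d) • o ≠ 0 := by
      intro h
      have h1 : ⟪ν 0, A 0 - (σ / d) • o⟫ = 0 := by rw [h, inner_zero_right]
      have h2 : ⟪ν (Fin.last n), A 0 - (σ / d) • o⟫ = 0 := by rw [h, inner_zero_right]
      rw [inner_sub_right, real_inner_smul_right, hνA, hνo] at h1 h2
      rw [if_pos rfl] at h1
      rw [if_neg h01.symm] at h2
      linarith
    have h := real_inner_self_nonneg (x := A 0 - (σ / d) • o)
    have h' : ⟪A 0 - (σ / d) • o, A 0 - (σ / d) • o⟫ ≠ 0 := inner_self_ne_zero.2 hne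
    have h2 := lt_of_le_of_ne h h'.symm
    simp only [inner_sub_left, inner_sub_right, real_inner_smul_left, real_inner_smul_right, hA,
      hAo, real_inner_comm (A 0) o, ho] at h2
    have : d * N - σ ^ 2 = d * (N - σ / d * σ - (σ / d * σ - σ / d * (σ / d * d))) := by
      field_simp; ring
    rw [this]
    positivity
  -- `(d * M - (σ ^ 2)⁻¹) / d` is the squared norm of the gradients of the barycentric coordinates
  -- of the base.
  have hM : 0 ≤ d * M - (σ ^ 2)⁻¹ := by
    have h2 := real_inner_self_nonneg (x := ν 0 - (σ⁻¹ / d) • o)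
    simp only [inner_sub_left, inner_sub_right, real_inner_smul_left, real_inner_smul_right, hν,
      hνo, real_inner_comm (ν 0) o, ho] at h2
    have : d * M - (σ ^ 2)⁻¹
        = d * (M - σ⁻¹ / d * σ⁻¹ - (σ⁻¹ / d * σ⁻¹ - σ⁻¹ / d * (σ⁻¹ / d * d))) := by
      field_simp; ring
    rw [this]
    positivity
  have hd1 : 0 < d ^ 2 - 1 := by nlinarith
  -- The point `x • o` with `d * x = y + σ` has height `y / √d` over the base. The unit vectors from it
  -- to the vertices sum to zero for this value of `y`.
  obtain ⟨y, hy, hy2⟩ : ∃ y : ℝ, 0 < y ∧ y ^ 2 * (d ^ 2 - 1) = d * N - σ ^ 2 :=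
    ⟨√((d * N - σ ^ 2) / (d ^ 2 - 1)), Real.sqrt_pos.2 (div_pos hN hd1), by
      rw [Real.sq_sqrt (div_pos hN hd1).le, div_mul_cancel₀ _ hd1.ne']⟩
  -- The apex `c • o` with `d * c = η + σ` has height `η / √d`. Equating the distances of `x • o` to
  -- the base and to a lateral facet and solving for `η` gives `η = 2 * y / κ`.
  obtain ⟨κ, hκ⟩ : ∃ κ, κ = 1 - (d * M - (σ ^ 2)⁻¹) * y ^ 2 := ⟨_, rfl⟩
  have hκ0 : 0 < κ := by
    rw [← hy2] at hround
    have : y ^ 2 * (d * M - (σ ^ 2)⁻¹) < 1 := by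
      by_contra! h
      nlinarith [mul_le_mul_of_nonneg_right h hd1.le]
    rw [hκ]; linarith
  have hκ1 : κ ≤ 1 := by rw [hκ]; nlinarith [mul_nonneg hM (sq_nonneg y)]
  obtain ⟨η, hη⟩ : ∃ η, η = 2 * y / κ := ⟨_, rfl⟩
  have hηκ : η * κ = 2 * y := by rw [hη]; field_simp
  have hη0 : 0 < η := by rw [hη]; positivity
  have hyη : y < η := by nlinarith
  obtain ⟨c, hc⟩ : ∃ c, c = (η + σ) / d := ⟨_, rfl⟩
  obtain ⟨x, hx⟩ : ∃ x, x = (y + σ) / d := ⟨_, rfl⟩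
  have hcd : d * c = η + σ := by rw [hc]; field_simp
  have hxd : d * x = y + σ := by rw [hx]; field_simp
  have hcx : 0 < c - x := by
    have : d * (c - x) = η - y := by linarith
    exact (mul_pos_iff_of_pos_left hd0).1 (by linarith)
  obtain ⟨τ, hτ⟩ : ∃ τ, τ = c / (σ * η) := ⟨_, rfl⟩
  have hτe : τ * (σ * η) = c := by rw [hτ]; field_simp
  let p : Fin (n + 2) → V := Fin.cons (c • o) A
  let g : Fin (n + 2) → V := Fin.cons (η⁻¹ • o) fun i => ν i - τ • o
  -- `g i` is the gradient of the `i`-th barycentric coordinate.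
  have hg : ∀ i j, j ≠ i → ⟪p i - p j, g i⟫ = 1 := by
    intro i j hij
    cases i using Fin.cases with
    | zero =>
      cases j using Fin.cases with
      | zero => exact absurd rfl hij
      | succ j =>
        simp only [p, g, Fin.cons_zero, Fin.cons_succ, inner_sub_left, real_inner_smul_left,
          real_inner_smul_right, ho, hAo]
        rw [← mul_sub, inv_mul_eq_one₀ hη0.ne']
        linarith
    | succ i =>
      cases j using Fin.cases with
      | zero =>
        simp only [p, g, Fin.cons_zero, Fin.cons_succ, inner_sub_left, inner_sub_right,
          real_inner_smul_left, real_inner_smul_right, ho, hAo, real_inner_comm (ν i), hνA, hνo]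
        have : τ * (c * d) = τ * σ + c * σ⁻¹ := by
          rw [mul_comm c, hcd, ← hτe]
          field_simp
          ring
        simp only [if_true]
        linarith
      | succ j =>
        have hij' : i ≠ j := fun h => hij (by rw [h])
        simp [p, g, inner_sub_left, inner_sub_right, real_inner_smul_right, hAo,
          real_inner_comm (ν i), hνA, hij']
  have hp : AffineIndependent ℝ p := by
    rw [affineIndependent_iff_of_fintype]
    intro w hw hw0 i
    rw [Finset.weightedVSub_eq_linear_combination _ hw] at hw0
    have h0 : ⟪∑ j, w j • (p i - p j), g i⟫ = 0 := by
      simp only [smul_sub, Finset.sum_sub_distrib, ← Finset.sum_smul, hw, hw0]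
      simp
    have h1 : ∀ j, ⟪w j • (p i - p j), g i⟫ = w j - if j = i then w i else 0 := by
      intro j
      split_ifs with h
      · simp [h]
      · rw [real_inner_smul_left, hg i j h, mul_one, sub_zero]
    simpa [sum_inner, h1, hw] using h0
  have hoX : ‖o‖ ^ 2 = d := by rw [← real_inner_self_eq_norm_sq, ho]
  have ho0 : 0 < ‖o‖ := by
    have : ‖o‖ ^ 2 ≠ 0 := by rw [hoX]; exact hd0.ne'
    exact lt_of_le_of_ne (norm_nonneg _) fun h => this (by rw [← h]; simp)
  refine ⟨⟨p, hp⟩, c • o, rfl, ?_, ?_⟩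
  · set S : Simplex ℝ V (n + 1) := ⟨p, hp⟩
    have hinc : S.incenter = x • o := by
      -- The barycentric coordinates of `x • o`.
      let w : Fin (n + 2) → ℝ := Fin.cons (y / η) fun _ => (1 - y / η) / d
      have hw : ∑ i, w i = 1 := by
        rw [Fin.sum_univ_succ]
        simp only [w, Fin.cons_zero, Fin.cons_succ, Finset.sum_const, Finset.card_univ,
          Fintype.card_fin, nsmul_eq_mul]
        push_cast
        rw [← hdd]
        field_simp
        ring
      have hgn : ∀ i, ‖ν i - τ • o‖ = (1 - y / η) / (‖o‖ * y) := by
        intro i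
        have hpos : 0 ≤ (1 - y / η) / (‖o‖ * y) := by
          have : y / η < 1 := (div_lt_one hη0).2 hyη
          have : 0 < 1 - y / η := by linarith
          positivity
        rw [← sq_eq_sq₀ (norm_nonneg _) hpos, ← real_inner_self_eq_norm_sq, div_pow, mul_pow, hoX]
        simp only [inner_sub_left, inner_sub_right, real_inner_smul_left, real_inner_smul_right,
          hν, hνo, real_inner_comm (ν i) o, ho]
        have hτ' : τ = (η + σ) / (d * (σ * η)) := by rw [hτ, hc]; field_simp
        have hMe : M = ((1 - κ) / y ^ 2 + (σ ^ 2)⁻¹) / d := by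
          rw [hκ]; field_simp; ring
        have hκ' : κ = 2 * y / η := by rw [← hηκ]; field_simp
        rw [hMe, hκ', hτ']
        field_simp
        ring
      have hr : ∀ i, w i = (y / ‖o‖) * ‖g i‖ := by
        intro i
        cases i using Fin.cases with
        | zero =>
          simp only [w, g, Fin.cons_zero, norm_smul, norm_inv, Real.norm_of_nonneg hη0.le]
          field_simp
        | succ i =>
          simp only [w, g, Fin.cons_succ, hgn]
          rw [← hoX]
          field_simp
      rw [S.incenter_eq_sum_of_inner hd g hg hw hr, Fin.sum_univ_succ]
      simp only [S, p, w, Fin.cons_zero, Fin.cons_succ, ← Finset.smul_sum, hsum, smul_smul,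
        ← add_smul]
      congr 1
      rw [hc, hx]
      field_simp
      ring
    rw [hinc]
    -- By the choice of `y`, each unit vector from `x • o` to a base vertex has axial component `-1 / d`.
    have hAX : ∀ i, ‖A i - x • o‖ = ‖o‖ * y := by
      intro i
      rw [← sq_eq_sq₀ (norm_nonneg _) (by positivity), ← real_inner_self_eq_norm_sq, mul_pow, hoX]
      simp only [inner_sub_left, inner_sub_right, real_inner_smul_left, real_inner_smul_right,
        hA, hAo, real_inner_comm (A i) o, ho]
      have hN' : N = (y ^ 2 * (d ^ 2 - 1) + σ ^ 2) / d := by rw [hy2]; field_simp; ring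
      rw [hN', hx]
      field_simp
      ring
    refine S.isFermatTorricelliPoint_of_sum_unit_eq_zero (i := 0) (j := Fin.succ 0) ?_ ?_
    · rw [Fin.sum_univ_succ]
      simp only [S, p, Fin.cons_zero, Fin.cons_succ, hAX, ← Finset.smul_sum,
        Finset.sum_sub_distrib, hsum, Finset.sum_const, Finset.card_univ, Fintype.card_fin,
        ← Nat.cast_smul_eq_nsmul ℝ, smul_smul, ← sub_smul, norm_smul, Real.norm_of_nonneg hcx.le,
        ← add_smul]
      push_cast
      rw [← hdd, mul_comm x, hxd, ← zero_smul ℝ o]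
      congr 1
      field_simp
      ring
    · simp only [S, p, Fin.cons_zero, Fin.cons_succ]
      rw [LinearIndependent.pair_iff]
      intro s t hst
      have h1 : ⟪ν 0, s • (c • o - x • o) + t • (A 0 - x • o)⟫ = 0 := by
        rw [hst, inner_zero_right]
      have h2 : ⟪ν (Fin.last n), s • (c • o - x • o) + t • (A 0 - x • o)⟫ = 0 := by
        rw [hst, inner_zero_right]
      simp only [inner_add_right, inner_sub_right, real_inner_smul_right, hνA, hνo, if_true,
        if_neg h01.symm] at h1 h2
      have ht : t = 0 := by linarith
      refine ⟨?_, ht⟩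
      rw [ht] at h1
      have : s * ((c - x) * σ⁻¹) = 0 := by linarith
      exact (mul_eq_zero.1 this).resolve_right (by positivity)
  -- The radicand is `‖c • o - A i‖ ^ 2`.
  · refine ⟨√(c * (c * d) - 2 * c * σ + N), fun i hi => ?_⟩
    cases i using Fin.cases with
    | zero => exact absurd rfl hi
    | succ i =>
      simp only [p, Fin.cons_zero, Fin.cons_succ, dist_eq_norm]
      rw [← Real.sqrt_sq (norm_nonneg (c • o - A i)), ← real_inner_self_eq_norm_sq]
      simp only [inner_sub_left, inner_sub_right, real_inner_smul_left, real_inner_smul_right,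
        hA, hAo, real_inner_comm (A i) o, ho]
      congr 1
      ring

end Affine.Simplex

/-! ### A cyclically symmetric base -/

section Cyclic

variable {n : ℕ}

/-- The cyclic shift of coordinates of `ℝ^(n+1)`, which takes the `i`-th standard basis vector to
the `(i+s)`-th one, as a linear isometry. -/
noncomputable def cyclicShift (s : Fin (n + 1)) :
    EuclideanSpace ℝ (Fin (n + 1)) ≃ₗᵢ[ℝ] EuclideanSpace ℝ (Fin (n + 1)) :=
  LinearIsometryEquiv.piLpCongrLeft 2 ℝ ℝ (Equiv.addRight s)

lemma cyclicShift_apply (s : Fin (n + 1)) (v : EuclideanSpace ℝ (Fin (n + 1))) (i : Fin (n + 1)) :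
    cyclicShift s v i = v (i - s) := by
  simp [cyclicShift, LinearIsometryEquiv.piLpCongrLeft_apply, Equiv.piCongrLeft'_apply,
    sub_eq_add_neg]

lemma cyclicShift_cyclicShift (s t : Fin (n + 1)) (v : EuclideanSpace ℝ (Fin (n + 1))) :
    cyclicShift s (cyclicShift t v) = cyclicShift (t + s) v := by
  ext i
  simp only [cyclicShift_apply, sub_sub, add_comm]

/-- The vertices of a simplex in the hyperplane `∑ xᵢ = σ` that is symmetric under cyclic shifts,
obtained from the regular simplex with vertices `σ eᵢ` by moving each vertex by the fraction `δ` of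
an edge towards its successor. -/
noncomputable def cyclicVertex (σ δ : ℝ) (i : Fin (n + 1)) : EuclideanSpace ℝ (Fin (n + 1)) :=
  σ • ((1 - δ) • EuclideanSpace.single i 1 + δ • EuclideanSpace.single (i + 1) 1)

lemma cyclicVertex_apply (σ δ : ℝ) (i j : Fin (n + 1)) :
    cyclicVertex σ δ i j = σ * ((1 - δ) * (if j = i then 1 else 0)
      + δ * (if j = i + 1 then 1 else 0)) := by
  simp [cyclicVertex, mul_add]

lemma cyclicShift_cyclicVertex (σ δ : ℝ) (i s : Fin (n + 1)) :
    cyclicShift s (cyclicVertex σ δ i) = cyclicVertex σ δ (i + s) := by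
  ext j
  simp only [cyclicShift_apply, cyclicVertex_apply, sub_eq_iff_eq_add, add_right_comm]

lemma inner_cyclicVertex (σ δ : ℝ) (v : EuclideanSpace ℝ (Fin (n + 1))) (i : Fin (n + 1)) :
    ⟪v, cyclicVertex σ δ i⟫ = σ * ((1 - δ) * v i + δ * v (i + 1)) := by
  simp [cyclicVertex, inner_smul_right, inner_add_right, EuclideanSpace.inner_single_right, mul_add]

lemma inner_cyclicVertex_cyclicVertex (σ δ : ℝ) (i j : Fin (n + 1)) :
    ⟪cyclicVertex σ δ i, cyclicVertex σ δ j⟫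
      = σ ^ 2 * ((1 - δ) * ((1 - δ) * (if j = i then 1 else 0) + δ * (if j = i + 1 then 1 else 0))
        + δ * ((1 - δ) * (if j + 1 = i then 1 else 0) + δ * (if j + 1 = i + 1 then 1 else 0))) := by
  rw [inner_cyclicVertex, cyclicVertex_apply, cyclicVertex_apply]
  ring

lemma dist_cyclicVertex_le {σ δ : ℝ} (hσ : 0 ≤ σ) (hδ : 0 ≤ δ) (i : Fin (n + 1)) :
    dist (cyclicVertex σ δ i) (cyclicVertex σ 0 i) ≤ 2 * (σ * δ) := by
  have h : cyclicVertex σ δ i - cyclicVertex σ 0 i = (σ * δ) •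
      (EuclideanSpace.single (i + 1) (1 : ℝ) - EuclideanSpace.single i 1) := by
    simp only [cyclicVertex]
    module
  have h' := norm_sub_le (EuclideanSpace.single (i + 1) (1 : ℝ)) (EuclideanSpace.single i 1)
  simp only [PiLp.norm_single, norm_one] at h'
  rw [dist_eq_norm, h, norm_smul, Real.norm_of_nonneg (by positivity)]
  linarith [mul_le_mul_of_nonneg_left h' (mul_nonneg hσ hδ)]

/-- The vertices `cyclicVertex σ δ i` have a dual family of vectors of equal norm. The map
`v ↦ (⟪v, cyclicVertex σ δ i⟫)ᵢ` is a perturbation of `σ • id` by multiples of isometries, which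
gives both its invertibility and the bound on its inverse. -/
lemma exists_dual_cyclicVertex {σ δ : ℝ} (hσ : 0 < σ) (hδ : 0 ≤ δ) (hδ' : δ < 1 / 2) :
    ∃ ν : Fin (n + 1) → EuclideanSpace ℝ (Fin (n + 1)),
      (∀ i j, ⟪ν i, cyclicVertex σ δ j⟫ = if i = j then 1 else 0) ∧
      (∀ i, ‖ν i‖ = ‖ν 0‖) ∧ σ * (1 - 2 * δ) * ‖ν 0‖ ≤ 1 := by
  let L : EuclideanSpace ℝ (Fin (n + 1)) →ₗ[ℝ] EuclideanSpace ℝ (Fin (n + 1)) :=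
    σ • ((1 - δ) • LinearMap.id + δ • (cyclicShift (-1)).toLinearEquiv.toLinearMap)
  have hL : ∀ v i, L v i = ⟪v, cyclicVertex σ δ i⟫ := by
    intro v i
    simp [L, inner_cyclicVertex, cyclicShift_apply, mul_add]
  have hbound : ∀ v, σ * (1 - 2 * δ) * ‖v‖ ≤ ‖L v‖ := by
    intro v
    have h := norm_sub_le_norm_add ((1 - δ) • v) (δ • cyclicShift (-1) v)
    rw [norm_smul, norm_smul, LinearIsometryEquiv.norm_map, Real.norm_of_nonneg hδ,
      Real.norm_of_nonneg (by linarith : 0 ≤ 1 - δ)] at h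
    have hLv : L v = σ • ((1 - δ) • v + δ • cyclicShift (-1) v) := rfl
    rw [hLv, norm_smul, Real.norm_of_nonneg hσ.le, mul_assoc]
    refine mul_le_mul_of_nonneg_left ?_ hσ.le
    linarith
  have hpos : 0 < σ * (1 - 2 * δ) := mul_pos hσ (by linarith)
  have hinj : Function.Injective L := by
    rw [← LinearMap.ker_eq_bot, LinearMap.ker_eq_bot']
    intro v hv
    have h := hbound v
    rw [hv, norm_zero] at h
    exact norm_le_zero_iff.1 (nonpos_of_mul_nonpos_right h hpos)
  obtain ⟨v, hv⟩ := LinearMap.injective_iff_surjective.1 hinj (EuclideanSpace.single 0 1)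
  refine ⟨fun i => cyclicShift i v, fun i j => ?_, fun i => ?_, ?_⟩
  · have h : cyclicVertex σ δ j = cyclicShift i (cyclicVertex σ δ (j - i)) := by
      rw [cyclicShift_cyclicVertex, sub_add_cancel]
    rw [h, LinearIsometryEquiv.inner_map_map, ← hL, hv]
    simp [sub_eq_zero, eq_comm]
  · simp only [LinearIsometryEquiv.norm_map]
  · rw [LinearIsometryEquiv.norm_map]
    simpa [hv] using hbound v

end Cyclic

/-! ### The simplex -/

theorem theorem3p3 (d : ℕ) [NeZero d] (hd : 4 ≤ d) (ε : ℝ) (hε : 0 < ε) :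
    ∃ (S : Affine.Simplex ℝ (EuclideanSpace ℝ (Fin d)) d) (a : Fin (d + 1)),
      S.IsFermatTorricelliPoint S.incenter ∧
      ¬ S.Equifacetal ∧
      S.IsIsoscelesAt a ∧
      (S.faceOpposite a).Equifacetal ∧
      ¬ (S.faceOpposite a).Equilateral ∧
      ∃ T₀ : Affine.Simplex ℝ (EuclideanSpace ℝ (Fin d)) (d - 1),
        (∀ i j, i ≠ j → dist (T₀.points i) (T₀.points j) = 1) ∧
        ∀ i, dist ((S.faceOpposite a).points i) (T₀.points i) < ε := by
  obtain ⟨n, rfl⟩ : ∃ n, d = n + 1 := ⟨d - 1, by omega⟩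
  have hn : 3 ≤ n := by omega
  have hn' : (3 : ℝ) ≤ n := by exact_mod_cast hn
  -- For `σ = 1 / √2` the points `σ eᵢ` form a regular simplex of edge length `1`.
  obtain ⟨σ, hσ, hσ2⟩ : ∃ σ : ℝ, 0 < σ ∧ σ ^ 2 = 1 / 2 :=
    ⟨√(1 / 2), by positivity, Real.sq_sqrt (by norm_num)⟩
  -- The last bound on `δ` keeps the base round enough for the existence of the apex.
  obtain ⟨δ, hδ, hδε, hδn⟩ : ∃ δ : ℝ, 0 < δ ∧ 2 * δ < ε ∧ 4 * δ * (n + 3) ≤ 1 := by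
    refine ⟨min (ε / 4) (1 / (4 * (n + 3))), by positivity, ?_, ?_⟩
    · linarith [min_le_left (ε / 4) (1 / (4 * ((n : ℝ) + 3)))]
    · have h := min_le_right (ε / 4) (1 / (4 * ((n : ℝ) + 3)))
      rw [le_div_iff₀ (by positivity)] at h
      linarith
  have hδ2 : δ < 1 / 4 := by nlinarith
  obtain ⟨ν, hνA, hν, hν0⟩ := exists_dual_cyclicVertex (n := n) hσ hδ.le (by linarith)
  let A : Fin (n + 1) → EuclideanSpace ℝ (Fin (n + 1)) := cyclicVertex σ δ
  let o : EuclideanSpace ℝ (Fin (n + 1)) := WithLp.toLp 2 fun _ => 1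
  -- As `4 ≤ n + 1`, the residues `0`, `1`, `2`, `3` are distinct.
  have h1 : (1 : Fin (n + 1)) ≠ 0 := by
    simp [Fin.ext_iff, Nat.mod_eq_of_lt (show 1 < n + 1 by omega)]
  have h2 : (1 + 1 : Fin (n + 1)) ≠ 0 := by
    simp [Fin.ext_iff, Fin.val_add, Nat.mod_eq_of_lt (show 2 < n + 1 by omega)]
  have h3 : (1 + 1 + 1 : Fin (n + 1)) ≠ 0 := by
    simp [Fin.ext_iff, Fin.val_add, Nat.mod_eq_of_lt (show 3 < n + 1 by omega)]
  have hA : ∀ i, ⟪A i, A i⟫ = σ ^ 2 * ((1 - δ) ^ 2 + δ ^ 2) := by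
    intro i
    simp only [A, inner_cyclicVertex_cyclicVertex, add_eq_left, left_eq_add, h1, if_true, if_false]
    ring
  obtain ⟨S, P, hS, hFT, hiso⟩ :=
    Affine.Simplex.exists_isosceles_incenter_isFermatTorricelliPoint
    (V := EuclideanSpace ℝ (Fin (n + 1))) (n := n) (o := o) (A := A) (ν := ν)
    (M := ‖ν 0‖ ^ 2) (by simp) (by omega) hσ (by rw [PiLp.inner_apply]; simp [o])
    (by
      intro i
      simp only [A]
      rw [real_inner_comm, inner_cyclicVertex]
      simp [o])
    (by
      ext j
      simp only [A, PiLp.smul_apply, WithLp.ofLp_sum, Finset.sum_apply, cyclicVertex_apply]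
      rw [← Finset.mul_sum, Finset.sum_add_distrib, ← Finset.mul_sum, ← Finset.mul_sum]
      simp [o, ← sub_eq_iff_eq_add])
    hA (by intro i; rw [real_inner_self_eq_norm_sq, hν i]) hνA
    (by
      have hq : σ ^ 2 * ‖ν 0‖ ^ 2 * (1 - 2 * δ) ^ 2 ≤ 1 := by
        have := pow_le_one₀ (n := 2)
          (mul_nonneg (mul_nonneg hσ.le (by linarith : 0 ≤ 1 - 2 * δ)) (norm_nonneg (ν 0))) hν0
        linarith
      have hb : (n + 1) * (σ ^ 2 * ‖ν 0‖ ^ 2) < (n + 3 : ℝ) := by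
        have hδ1 : 0 < (1 - 2 * δ) ^ 2 := by nlinarith
        have hδ3 : (n + 1 : ℝ) < (n + 3) * (1 - 2 * δ) ^ 2 := by nlinarith [sq_nonneg δ]
        have hq' := mul_le_mul_of_nonneg_left hq (by positivity : (0 : ℝ) ≤ n + 1)
        refine lt_of_mul_lt_mul_right ?_ hδ1.le
        linarith
      have ha0 : 0 < (n + 1) * ((1 - δ) ^ 2 + δ ^ 2) - 1 := by nlinarith [sq_nonneg (1 - 2 * δ)]
      have ha1 : (n + 1) * ((1 - δ) ^ 2 + δ ^ 2) - 1 ≤ (n : ℝ) := by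
        have : (1 - δ) ^ 2 + δ ^ 2 ≤ 1 := by nlinarith
        nlinarith
      calc _ = ((n + 1) * ((1 - δ) ^ 2 + δ ^ 2) - 1) * ((n + 1) * (σ ^ 2 * ‖ν 0‖ ^ 2) - 1) := by
            field_simp
        _ < ((n + 1) * ((1 - δ) ^ 2 + δ ^ 2) - 1) * (n + 2) := by
            refine mul_lt_mul_of_pos_left ?_ ha0
            linarith
        _ ≤ n * (n + 2) := mul_le_mul_of_nonneg_right ha1 (by positivity)
        _ = _ := by ring)
  have hface : ∀ i, (S.faceOpposite 0).points i = A i := by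
    intro i
    rw [Affine.Simplex.faceOpposite_point_eq_point_succAbove, hS]
    rfl
  have hequi : ¬ (S.faceOpposite 0).Equilateral := by
    rintro ⟨r, hr⟩
    -- Consecutive vertices share a coordinate, so their inner product is positive, while that of the
    -- vertices `0` and `2` vanishes.
    have hd1 := hr (0 : Fin (n + 1)) (1 : Fin (n + 1)) h1.symm
    have hd2 := hr (0 : Fin (n + 1)) (1 + 1 : Fin (n + 1)) h2.symm
    rw [hface, hface, dist_eq_norm] at hd1 hd2
    have h := congrArg (· ^ 2) (hd1.trans hd2.symm)
    simp only [norm_sub_sq_real] at h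
    simp only [← real_inner_self_eq_norm_sq, hA] at h
    simp only [A, inner_cyclicVertex_cyclicVertex, zero_add, h1, h2, h3, add_eq_left,
      add_eq_right, if_true, if_false] at h
    have : 0 < σ ^ 2 * ((1 - δ) * δ) := by
      have : 0 < 1 - δ := by linarith
      positivity
    linarith
  refine ⟨S, 0, hFT, ?_, hiso, ?_, hequi, ?_⟩
  · intro hSe
    obtain ⟨l, hl⟩ := hiso
    refine hequi ⟨l, fun i j hij => ?_⟩
    rw [Affine.Simplex.faceOpposite_point_eq_point_succAbove,
      Affine.Simplex.faceOpposite_point_eq_point_succAbove]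
    exact hSe.dist_eq_of_isIsoscelesAt hl fun h => hij (Fin.succAbove_right_injective h)
  · refine Affine.Simplex.equifacetal_of_transitive _ fun i j => ?_
    refine ⟨Equiv.addRight (j - i : Fin (n + 1)), add_sub_cancel i j, fun k l => ?_⟩
    rw [hface, hface, hface, hface]
    simp only [A, Equiv.coe_addRight, ← cyclicShift_cyclicVertex]
    exact LinearIsometryEquiv.dist_map _ _ _
  · obtain ⟨μ, hμ, -, -⟩ := exists_dual_cyclicVertex (n := n) hσ le_rfl one_half_pos
    have hind : LinearIndependent ℝ (cyclicVertex (n := n) σ 0) := by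
      rw [Fintype.linearIndependent_iff]
      intro w hw i
      have h : ⟪μ i, ∑ j, w j • cyclicVertex σ 0 j⟫ = 0 := by rw [hw, inner_zero_right]
      simpa [inner_sum, real_inner_smul_right, hμ] using h
    refine ⟨⟨cyclicVertex (n := n) σ 0, hind.affineIndependent⟩, fun i j hij => ?_, fun i => ?_⟩
    · rw [dist_eq_norm, ← sq_eq_sq₀ (norm_nonneg _) zero_le_one, norm_sub_sq_real,
        ← real_inner_self_eq_norm_sq, ← real_inner_self_eq_norm_sq]
      simp only [inner_cyclicVertex_cyclicVertex, hσ2, if_true, if_neg (Ne.symm hij)]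
      norm_num
    · rw [hface]
      have hσ1 : σ < 1 := by nlinarith
      refine (dist_cyclicVertex_le hσ.le hδ.le i).trans_lt ?_
      nlinarith
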